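/- **Notation.** For $i,j\ge 0$ let ${j\brace i}$ be the Stirling number of the second kind (the number of partitions of a $j$-element set into $i$ nonempty blocks; it is $0$ for $i>j$). Upper triangular matrices have rational entries and are indexed by $i,j\in\{0,1,2,\dots\}$; let $S=({j\brace i})_{i,j\ge0}$. For an upper triangular matrix $M$ with ones on the diagonal put $\log M=\sum_{n\ge1}\frac{(-1)^{n+1}}{n}(M-1)^n$, and for any upper triangular $M=(M_{ij})$ put $M^+=(M_{i+1,j+1})_{i,j\ge0}$. For $f\in z+z^2\mathbb Q[[z]]$ the iteration matrix $[f]$ is defined by $\frac{1}{i!}f^i=\sum_j[f]_{ij}\frac{z^j}{j!}$; for $h=\sum_n h_nz^n\in z\mathbb Q[[z]]$ the infinitesimal iteration matrix $\langle h\rangle$ has the entries $\langle h\rangle_{ij}=\frac{j!}{i!}\,i\,h_{j-i+1}$ for $i\le j$, and $0$ for $i>j$. The iterative logarithm $\operatorname{itlog}(f)$ is the unique $h\in z^2\mathbb Q[[z]]$ with $\log[f]=\langle h\rangle$. Define rational numbers $a_{d,m}$ by $$\sum_{b=1}^{d+1}\binom{d}{b-1}\frac{(-1)^{d-b+1}}{d!}\cdot\frac1{1-b\psi}=\sum_{m}a_{d,m}\psi^m\in\mathbb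 Q[[\psi]].$$ On $R=\mathbb Q[z][[t_0,t_1,\dots]]$, with $\partial_n=\partial/\partial t_n$, consider the operators $$L_k=\sum_{\substack{0\le r\le k,\ k_1+\cdots+k_r=k\\ k_1,\dots,k_r>0,\ n_1,\dots,n_r\ge0}}\frac1{r!}\,a_{n_1,n_1+k_1}\cdots a_{n_r,n_r+k_r}\,t_{n_1+k_1}\cdots t_{n_r+k_r}\,\partial_{n_1}\cdots\partial_{n_r}\quad(k>0),\qquad L_0=\mathrm{id},$$ and $\mathbf L=\sum_{k\ge0}z^kL_k$. The Shadrin–Zvonkine numbers are rational numbers $\alpha_{n,n+k}$ ($n\ge0$, $k>0$) such that, with $l_k=\sum_n\alpha_{n,n+k}t_{n+k}\partial_n$ and $\mathbf l=\sum_{k>0}z^kl_k$, one has $\mathbf L(f)=\sum_{n\ge0}\frac1{n!}\mathbf l^n(f)$ for all $f\in R$. (All sums of operators are formed coefficient by coefficient; only finitely many terms contribute to each coefficient.) **Proposition.** The series $e^z-1$ has a unique iterative logarithm $h=\sum_{n\ge1}h_nz^n\in z^2\mathbb Q[[z]]$. Put $c_n=n!\,h_n$ for $n\ge1$. Then: 1.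 the entries of the matrix $\log(S)^+$ are $(\log(S)^+)_{ij}=c_{j-i+1}\binom{j+1}{i}$ for all $i<j$; 2. for any Shadrin–Zvonkine numbers $\alpha_{ij}$ ($i<j$), the matrix $A=(\alpha_{ij})$ with $\alpha_{ij}:=0$ for $i\ge j$ equals $\log(S)^+$; hence $$\alpha_{ij}=c_{j-i+1}\binom{j+1}{i}\qquad\text{for all } i<j,$$ as conjectured by Shadrin and Zvonkine, where $(c_1,\dots,c_{13})=\left(0,1,-\tfrac12,\tfrac12,-\tfrac23,\tfrac{11}{12},-\tfrac34,-\tfrac{11}6,\tfrac{29}4,\tfrac{493}{12},-\tfrac{2711}6,-\tfrac{12406}{15},\tfrac{2636317}{60}\right)$; 3. for every $n\ge1$, $$c_n=\sum_{\substack{1\le k<n\\ 1<n_1<\cdots<n_{k-1}<n_k=n}}\frac{(-1)^{k+1}}{k}{n_2\brace n_1}{n_3\brace n_2}\cdots{n_k\brace n_{k-1}}.$$ -/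

import Mathlib

open scoped Nat PowerSeries Polynomial

noncomputable section

namespace ShadrinZvonkine

/-! ### Upper triangular bi-infinite matrices -/

/-- The ring of upper triangular matrices `(M i j)` over `ℚ`, indexed by `i, j ∈ {0, 1, 2, …}`:
`M i j = 0` unless `i ≤ j`, and `(M * N) i j = ∑ k ∈ Icc i j, M i k * N k j`. -/
abbrev Tri : Type := IncidenceAlgebra ℚ ℕ

/-- The matrix logarithm `log M = ∑_{n ≥ 1} (-1)^(n+1) (M - 1)^n / n` of an upper triangular matrix
`M` with ones on the diagonal. The entry of `(M - 1)^n` at `(i, j)` vanishes for `n > j - i`, so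
that each entry of the series is the finite sum below. -/
def Tri.log (M : Tri) : Tri where
  toFun i j := ∑ n ∈ Finset.Icc 1 (j - i), (-1 : ℚ) ^ (n + 1) / n * ((M - 1) ^ n) i j
  eq_zero_of_not_le' i j h := by
    rw [Nat.sub_eq_zero_of_le (not_le.1 h).le]
    simp

/-- `M⁺ = (M (i+1) (j+1))`: remove row `0` and column `0`. -/
def Tri.plus (M : Tri) : Tri where
  toFun i j := M (i + 1) (j + 1)
  eq_zero_of_not_le' _ _ h :=
    IncidenceAlgebra.apply_eq_zero_of_not_le (fun h' => h (Nat.le_of_succ_le_succ h')) M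

/-- The matrix `S` of the Stirling numbers of the second kind: the entry at `(i, j)` is the number
of partitions of a `j`-element set into `i` nonempty blocks. -/
def stirlingMatrix : Tri where
  toFun i j := (Nat.stirlingSecond j i : ℚ)
  eq_zero_of_not_le' i j h := by
    exact_mod_cast Nat.stirlingSecond_eq_zero_of_lt (not_le.1 h)

/-! ### Iteration matrices and the iterative logarithm -/

/-- The iteration matrix `[f]` of `f ∈ z ℚ⟦z⟧`, given by
`f ^ i / i! = ∑_j [f]_{ij} z ^ j / j!`. (For `i > j` the coefficient of `z ^ j` in `f ^ i` is zero,
as `f` has no constant term.) -/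
def iterationMatrix (f : ℚ⟦X⟧) : Tri where
  toFun i j := if i ≤ j then (j ! : ℚ) / (i ! : ℚ) * PowerSeries.coeff j (f ^ i) else 0
  eq_zero_of_not_le' _ _ h := if_neg h

/-- The infinitesimal iteration matrix `⟨h⟩` of `h = ∑ h_n z ^ n ∈ z ℚ⟦z⟧`, given by
`⟨h⟩_{ij} = (j! / i!) i h_{j-i+1}` for `i ≤ j`. -/
def infinitesimalMatrix (h : ℚ⟦X⟧) : Tri where
  toFun i j :=
    if i ≤ j then (j ! : ℚ) / (i ! : ℚ) * i * PowerSeries.coeff (j - i + 1) h else 0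
  eq_zero_of_not_le' _ _ h := if_neg h

/-- `h` is an iterative logarithm of the series `f = z + (higher terms)`: it lies in `z² ℚ⟦z⟧`,
and `log [f] = ⟨h⟩`. -/
def IsIterativeLog (f h : ℚ⟦X⟧) : Prop :=
  PowerSeries.X ^ 2 ∣ h ∧ (iterationMatrix f).log = infinitesimalMatrix h

/-! ### The differential operators of Shadrin and Zvonkine -/

/-- The ring `R = ℚ[z]⟦t₀, t₁, t₂, …⟧`. -/
abbrev R : Type := MvPowerSeries ℕ ℚ[X]

/-- The sum of a family in `R` in which every monomial occurs only finitely often: it is formed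
coefficient by coefficient. -/
def formalSum {ι : Type} (F : ι → R) : R := fun e => ∑ᶠ i, MvPowerSeries.coeff e (F i)

/-- The rational number `a_{d,m}`: the coefficient of `ψ ^ m` in
`∑_{b=1}^{d+1} binom(d, b-1) ((-1)^(d-b+1) / d!) · 1 / (1 - b ψ) ∈ ℚ⟦ψ⟧`. -/
def a (d m : ℕ) : ℚ :=
  PowerSeries.coeff m
    (∑ b ∈ Finset.Icc 1 (d + 1),
      PowerSeries.C ((d.choose (b - 1) : ℚ) * ((-1) ^ (d + 1 - b) / (d ! : ℚ))) *
        (1 - PowerSeries.C (b : ℚ) * PowerSeries.X : ℚ⟦X⟧)⁻¹)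

/-- The index set of the sum that defines `L_k`: a number `r ≤ k`, positive integers
`k₁, …, k_r` with sum `k`, and natural numbers `n₁, …, n_r`. -/
structure LIndex (k : ℕ) : Type where
  r : ℕ
  r_le : r ≤ k
  ks : Fin r → ℕ
  ks_pos : ∀ i, 0 < ks i
  ks_sum : ∑ i, ks i = k
  ns : Fin r → ℕ

/-- The operator `∂_{n₁} ⋯ ∂_{n_r}` on `R`, where `∂_n` is the partial derivative by `t_n`. -/
def iteratedPartial {r : ℕ} (ns : Fin r → ℕ) (f : R) : R :=
  (List.ofFn ns).foldr (fun n g => MvPowerSeries.pderiv ℚ[X] n g) f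

/-- The operator `L_k`, the sum of
`(1 / r!) a_{n₁,n₁+k₁} ⋯ a_{n_r,n_r+k_r} t_{n₁+k₁} ⋯ t_{n_r+k_r} ∂_{n₁} ⋯ ∂_{n_r}`
over all `r ≤ k`, all `k₁, …, k_r > 0` with sum `k` and all `n₁, …, n_r ≥ 0`. For `k = 0` only
`r = 0` occurs and `L₀` is the identity. -/
def L (k : ℕ) (f : R) : R :=
  formalSum fun p : LIndex k =>
    ((1 / (p.r ! : ℚ)) * ∏ i, a (p.ns i) (p.ns i + p.ks i)) •
      ((∏ i, (MvPowerSeries.X (p.ns i + p.ks i) : R)) * iteratedPartial p.ns f)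

/-- The operator `𝐋 = ∑_{k ≥ 0} z ^ k L_k`. -/
def bigL (f : R) : R := formalSum fun k : ℕ => (Polynomial.X ^ k : ℚ[X]) • L k f

/-- The operator `l_k = ∑_{n ≥ 0} α_{n,n+k} t_{n+k} ∂_n`. -/
def smallL (α : ℕ → ℕ → ℚ) (k : ℕ) (f : R) : R :=
  formalSum fun n : ℕ =>
    α n (n + k) • ((MvPowerSeries.X (n + k) : R) * MvPowerSeries.pderiv ℚ[X] n f)

/-- The operator `𝐥 = ∑_{k > 0} z ^ k l_k`. -/
def boldSmallL (α : ℕ → ℕ → ℚ) (f : R) : R :=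
  formalSum fun k : ℕ => (Polynomial.X ^ (k + 1) : ℚ[X]) • smallL α (k + 1) f

/-- The operator `exp T = ∑_{n ≥ 0} T ^ n / n!`. -/
def opExp (T : R → R) (f : R) : R :=
  formalSum fun n : ℕ => (1 / (n ! : ℚ)) • (T^[n]) f

/-- The defining property of the Shadrin–Zvonkine numbers `α_{n,n+k}` (`n ≥ 0`, `k > 0`): the
identity `𝐋 = exp 𝐥` of operators on `R`. Only the values `α i j` with `i < j` play a role. -/
def IsShadrinZvonkine (α : ℕ → ℕ → ℚ) : Prop :=
  ∀ f : R, bigL f = opExp (boldSmallL α) f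

/-- The strictly upper triangular matrix with the entries `α i j` for `i < j`. -/
def strictMatrix (α : ℕ → ℕ → ℚ) : Tri where
  toFun i j := if i < j then α i j else 0
  eq_zero_of_not_le' _ _ h := if_neg fun h' => h h'.le

/-! ### Chains -/

/-- The chains `1 < m₀ < m₁ < ⋯ < m_k = n` of `k + 1` natural numbers. -/
def chains (n k : ℕ) : Finset (Fin (k + 1) → ℕ) :=
  (Fintype.piFinset fun _ => Finset.Icc 2 n).filter fun m =>
    (∀ i : Fin k, m i.castSucc < m i.succ) ∧ m (Fin.last k) = n

/-- The sum of `((-1)^(k+1) / k) {n₂ brace n₁} ⋯ {n_k brace n_{k-1}}` over all `1 ≤ k < n` and all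
chains `1 < n₁ < ⋯ < n_k = n`. -/
def chainSum (n : ℕ) : ℚ :=
  ∑ k ∈ Finset.Ico 1 n, ∑ m ∈ chains n (k - 1),
    (-1 : ℚ) ^ (k + 1) / k *
      ∏ i : Fin (k - 1), (Nat.stirlingSecond (m i.succ) (m i.castSucc) : ℚ)

end ShadrinZvonkine

end

open scoped Nat PowerSeries Polynomial

namespace ShadrinZvonkine

open Finset

/-! For a unipotent `M`, each entry of `M ^ t` is a polynomial in `t` whose linear coefficient is
the entry of `log M`. Two such polynomials agree once they agree at all natural `t`, so statements
about logarithms reduce to statements about ordinary powers.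

For `M = [f]` and natural `t`, `[f]^t` is the iteration matrix of the `t`-fold iterate, so up to
factorials its row `i` is the `i`-th power of its row `1`. This persists for formal `t`.
Differentiating at `t = 0`, where row `1` is `z`, gives row `i` of `log [f]` as `i z^(i-1) h`, that
is `log [f] = ⟨h⟩`; row `1` recovers `h` (`isIterativeLog_linearTerm`, `IsIterativeLog.unique`).
Since `S = [e^z - 1]`, this yields the entries of `log S`.

For the Shadrin–Zvonkine numbers, compare the coefficients of the single variable `t_m` in `𝐋 t_i =
exp(𝐥) t_i`. On linear coefficients `𝐥` acts by the matrix `A` graded by powers of `z`, while only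
the terms of `𝐋` with `r ≤ 1` are seen. As `a_{d,m}` is the Stirling number of `(m+1, d+1)`, this
says `S⁺ = exp A`, whence `A = log(S⁺) = log(S)⁺`. The chain formula is row `1` of the logarithm
series of `S`, written out. -/

/-! ### Nilpotency and locality of entries -/

theorem Tri.pow_apply_eq_zero {N : Tri} (hN : ∀ i, N i i = 0) :
    ∀ {n i j : ℕ}, j - i < n → (N ^ n) i j = 0
  | 0, _, _, h => absurd h (Nat.not_lt_zero _)
  | n + 1, i, j, h => by
    rw [pow_succ, IncidenceAlgebra.mul_apply]
    refine sum_eq_zero fun k hk => ?_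
    rw [mem_Icc] at hk
    rcases hk.2.eq_or_lt with rfl | hkj
    · rw [hN, mul_zero]
    · rw [Tri.pow_apply_eq_zero hN (by omega), zero_mul]

theorem Tri.sub_one_apply_self {M : Tri} (hM : ∀ i, M i i = 1) (i : ℕ) : (M - 1) i i = 0 := by
  simp [hM]

@[simp]
theorem Tri.sum_apply {ι : Type*} (s : Finset ι) (F : ι → Tri) (i j : ℕ) :
    (∑ n ∈ s, F n) i j = ∑ n ∈ s, F n i j := by
  classical
  induction s using Finset.induction_on with
  | empty => simp
  | insert a s ha ih => simp [sum_insert ha, ih]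

theorem Tri.mul_apply_congr {M M' N N' : Tri} {i j : ℕ}
    (hM : ∀ k ∈ Icc i j, M i k = M' i k) (hN : ∀ k ∈ Icc i j, N k j = N' k j) :
    (M * N) i j = (M' * N') i j := by
  simp only [IncidenceAlgebra.mul_apply]
  exact sum_congr rfl fun k hk => by rw [hM k hk, hN k hk]

/-- A product at `(i, j)` only involves entries between `i` and `j`. Hence a series in a matrix may
be replaced by a polynomial when a single entry is at stake. -/
theorem Tri.pow_apply_congr {M M' : Tri} {d : ℕ} (h : ∀ i j, j - i ≤ d → M i j = M' i j) (n : ℕ) :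
    ∀ i j, j - i ≤ d → (M ^ n) i j = (M' ^ n) i j := by
  induction n with
  | zero => simp
  | succ n ih =>
    intro i j hij
    rw [pow_succ, pow_succ]
    refine Tri.mul_apply_congr (fun k hk => ih _ _ ?_) fun k hk => h _ _ ?_ <;>
      rw [mem_Icc] at hk <;> omega

/-! ### Powers of unipotent matrices as polynomials in the exponent -/

/-- The polynomial in `t` that is the entry at `(i, j)` of `M ^ t = ∑ n, t.choose n • (M - 1) ^ n`. -/
noncomputable def Tri.powPoly (M : Tri) (i j : ℕ) : ℚ[X] :=
  ∑ n ∈ range (j - i + 1), Polynomial.C (((M - 1) ^ n) i j / (n ! : ℚ)) * descPochhammer ℚ n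

/-- Binomial expansion of `(1 + (M - 1)) ^ k`: nilpotency cuts it at `n = j - i`, a bound
independent of `k`. -/
theorem Tri.powPoly_eval {M : Tri} (hM : ∀ i, M i i = 1) (i j k : ℕ) :
    (M.powPoly i j).eval (k : ℚ) = (M ^ k) i j := by
  have hz : ∀ n, j - i < n → ((M - 1) ^ n) i j = 0 := fun n hn =>
    Tri.pow_apply_eq_zero (Tri.sub_one_apply_self hM) hn
  have h1 : (M ^ k) i j = ∑ n ∈ range (k + 1), ((M - 1) ^ n) i j * (k.choose n : ℚ) := by
    conv_lhs => rw [← sub_add_cancel M 1, (Commute.one_right (M - 1)).add_pow, Tri.sum_apply]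
    refine sum_congr rfl fun n _ => ?_
    rw [one_pow, mul_one, ← nsmul_eq_mul', IncidenceAlgebra.constSMul_apply, nsmul_eq_mul, mul_comm]
  have h2 : (M.powPoly i j).eval (k : ℚ) =
      ∑ n ∈ range (j - i + 1), ((M - 1) ^ n) i j * (k.choose n : ℚ) := by
    rw [Tri.powPoly, Polynomial.eval_finsetSum]
    refine sum_congr rfl fun n _ => ?_
    rw [Polynomial.eval_mul, Polynomial.eval_C, descPochhammer_eval_eq_descFactorial,
      Nat.descFactorial_eq_factorial_mul_choose]
    have := Nat.factorial_ne_zero n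
    push_cast
    field_simp
  rw [h1, h2]
  rw [sum_subset (range_mono (show j - i + 1 ≤ j - i + k + 1 by omega)),
    ← sum_subset (range_mono (show k + 1 ≤ j - i + k + 1 by omega))]
  · intro n _ hn
    rw [Nat.choose_eq_zero_of_lt (by simpa using hn), Nat.cast_zero, mul_zero]
  · intro n _ hn
    rw [hz n (by simpa using hn), zero_mul]

theorem coeff_zero_descPochhammer_succ (n : ℕ) : (descPochhammer ℚ (n + 1)).coeff 0 = 0 := by
  rw [descPochhammer_succ_left, Polynomial.mul_coeff_zero, Polynomial.coeff_X_zero, zero_mul]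

theorem coeff_one_descPochhammer_succ (n : ℕ) :
    (descPochhammer ℚ (n + 1)).coeff 1 = (-1) ^ n * (n ! : ℚ) := by
  induction n with
  | zero => simp
  | succ n ih =>
    rw [descPochhammer_succ_right, mul_sub, Polynomial.coeff_sub, Polynomial.coeff_mul_X,
      coeff_zero_descPochhammer_succ, ← Polynomial.C_eq_natCast, Polynomial.coeff_mul_C, ih,
      Nat.factorial_succ]
    push_cast
    ring

/-- The linear coefficient of `t(t-1)⋯(t-n+1) / n!` is `(-1)^(n-1) / n`, the coefficient in the
logarithm series. -/
theorem Tri.coeff_one_powPoly (M : Tri) (i j : ℕ) : (M.powPoly i j).coeff 1 = M.log i j := by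
  change _ = ∑ n ∈ Icc 1 (j - i), (-1 : ℚ) ^ (n + 1) / n * ((M - 1) ^ n) i j
  rw [Tri.powPoly, Polynomial.finsetSum_coeff, sum_range_succ', range_eq_Ico,
    sum_Ico_add' (fun n => (Polynomial.C (((M - 1) ^ n) i j / (n ! : ℚ)) *
      descPochhammer ℚ n).coeff 1) 0 (j - i) 1]
  simp only [descPochhammer_zero, mul_one, Polynomial.coeff_C_succ, add_zero]
  refine sum_congr (by ext; simp) fun n hn => ?_
  obtain ⟨n, rfl⟩ : ∃ m, n = m + 1 := ⟨n - 1, by rw [mem_Icc] at hn; omega⟩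
  rw [Polynomial.coeff_C_mul, coeff_one_descPochhammer_succ, Nat.factorial_succ]
  have := Nat.factorial_ne_zero n
  push_cast
  field_simp
  ring

theorem polynomial_eq_of_forall_eval_natCast {p q : ℚ[X]}
    (h : ∀ k : ℕ, p.eval (k : ℚ) = q.eval (k : ℚ)) : p = q :=
  Polynomial.eq_of_infinite_eval_eq p q <|
    (Set.infinite_range_of_injective (Nat.cast_injective (R := ℚ))).mono <| by
      rintro _ ⟨k, rfl⟩
      exact h k

/-! ### The exponential series and the logarithm -/

theorem Tri.aeval_apply {A : Tri} (hA : ∀ i, A i i = 0) (p : ℚ[X]) {d i j : ℕ} (h : j - i ≤ d) :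
    (Polynomial.aeval A p) i j = ∑ n ∈ range (d + 1), p.coeff n * (A ^ n) i j := by
  have hd : p.natDegree < p.natDegree + d + 1 := by omega
  rw [Polynomial.aeval_eq_sum_range' hd, Tri.sum_apply,
    ← sum_subset (range_mono (show d + 1 ≤ p.natDegree + d + 1 by omega))]
  · exact sum_congr rfl fun n _ => rfl
  · intro n _ hn
    rw [IncidenceAlgebra.constSMul_apply, Tri.pow_apply_eq_zero hA (by simp at hn; omega), smul_zero]

/-- If `E = exp A` then `E ^ k = exp (k A)`, so the power polynomial of `E` at `(i, j)` has linear
coefficient `A i j`. -/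
theorem Tri.log_eq_of_eq_exp {A E : Tri} (hA : ∀ i, A i i = 0)
    (hE : ∀ i j, E i j = ∑ n ∈ range (j - i + 1), 1 / (n ! : ℚ) * (A ^ n) i j) : E.log = A := by
  have hE1 : ∀ i, E i i = 1 := fun i => by simp [hE]
  have hpow : ∀ i j k : ℕ,
      (E ^ k) i j = ∑ n ∈ range (j - i + 1), (k : ℚ) ^ n / (n ! : ℚ) * (A ^ n) i j := by
    intro i j k
    -- Up to distance `j - i`, `E` is a polynomial in `A`, so its `k`-th power can be computed in
    -- `ℚ[X]`, where `exp ^ k` rescales the variable by `k`.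
    set T : ℚ[X] := PowerSeries.trunc (j - i + 1) (PowerSeries.exp ℚ) with hT
    have h1 : ∀ i' j', j' - i' ≤ j - i → E i' j' = Polynomial.aeval A T i' j' := by
      intro i' j' h
      rw [Tri.aeval_apply hA T le_rfl, hE]
      refine sum_congr rfl fun n hn => ?_
      rw [mem_range] at hn
      rw [hT, PowerSeries.coeff_trunc, if_pos (by omega)]
      simp
    rw [Tri.pow_apply_congr h1 k i j le_rfl, ← map_pow, Tri.aeval_apply hA _ le_rfl]
    refine sum_congr rfl fun n hn => ?_
    rw [mem_range] at hn
    congr 1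
    have h2 := congrArg (fun p => p.coeff n)
      (PowerSeries.trunc_trunc_pow (PowerSeries.exp ℚ) (j - i + 1) k)
    simp only [PowerSeries.coeff_trunc, if_pos hn] at h2
    rw [← hT, ← Polynomial.coe_pow, Polynomial.coeff_coe, PowerSeries.exp_pow_eq_rescale_exp] at h2
    rw [h2]
    simp [PowerSeries.coeff_rescale, div_eq_mul_inv]
  ext i j hij
  set Q : ℚ[X] := ∑ n ∈ range (j - i + 1), Polynomial.C ((A ^ n) i j / (n ! : ℚ)) * Polynomial.X ^ n
    with hQ
  have hPQ : E.powPoly i j = Q := by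
    refine polynomial_eq_of_forall_eval_natCast fun k => ?_
    rw [Tri.powPoly_eval hE1, hpow, hQ, Polynomial.eval_finsetSum]
    refine sum_congr rfl fun n _ => ?_
    simp
    ring
  rw [← Tri.coeff_one_powPoly, hPQ, hQ, Polynomial.finsetSum_coeff]
  simp only [Polynomial.coeff_C_mul_X_pow]
  rw [sum_ite_eq]
  rcases hij.eq_or_lt with rfl | hlt
  · simp [hA]
  · rw [if_pos (by rw [mem_range]; omega)]
    simp

/-! ### Commutation and shift -/

/-- Near any given entry, `M.log` coincides with a polynomial in `M - 1`, which commutes with `M`.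
-/
theorem Tri.mul_log_comm {M : Tri} (hM : ∀ i, M i i = 1) : M * M.log = M.log * M := by
  ext i j hij
  set G : Tri := ∑ n ∈ Icc 1 (j - i), ((-1 : ℚ) ^ (n + 1) / n) • (M - 1) ^ n with hG
  have h1 : ∀ i' j', j' - i' ≤ j - i → M.log i' j' = G i' j' := by
    intro i' j' h
    rw [hG, Tri.sum_apply]
    refine sum_subset (Icc_subset_Icc_right h) fun n _ hn => ?_
    rw [Tri.pow_apply_eq_zero (Tri.sub_one_apply_self hM), mul_zero]
    simp at *
    omega
  have h2 : Commute M G := by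
    refine Commute.sum_right _ _ _ fun n _ => Commute.smul_right (Commute.pow_right ?_ _) _
    exact (Commute.refl M).sub_right (Commute.one_right M)
  calc (M * M.log) i j = (M * G) i j :=
        Tri.mul_apply_congr (fun _ _ => rfl) fun k hk => h1 _ _ (by rw [mem_Icc] at hk; omega)
    _ = (G * M) i j := by rw [h2.eq]
    _ = (M.log * M) i j :=
        Tri.mul_apply_congr (fun k hk => (h1 _ _ (by rw [mem_Icc] at hk; omega)).symm) fun _ _ => rfl

theorem Tri.plus_apply (M : Tri) (i j : ℕ) : M.plus i j = M (i + 1) (j + 1) := rfl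

theorem Tri.plus_mul (M N : Tri) : (M * N).plus = M.plus * N.plus := by
  ext i j _
  simp only [Tri.plus_apply, IncidenceAlgebra.mul_apply]
  rw [← map_add_right_Icc i j 1, sum_map]
  rfl

theorem Tri.plus_one : (1 : Tri).plus = 1 := by
  ext i j _
  simp [Tri.plus_apply]

theorem Tri.plus_pow (M : Tri) (n : ℕ) : (M ^ n).plus = M.plus ^ n := by
  induction n with
  | zero => simp [Tri.plus_one]
  | succ n ih => rw [pow_succ, pow_succ, Tri.plus_mul, ih]

theorem Tri.plus_log (M : Tri) : M.log.plus = M.plus.log := by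
  have h : M.plus - 1 = (M - 1).plus := by
    conv_lhs => rw [← Tri.plus_one]
    rfl
  ext i j _
  change ∑ n ∈ Icc 1 (j + 1 - (i + 1)), (-1 : ℚ) ^ (n + 1) / n * ((M - 1) ^ n).plus i j =
    ∑ n ∈ Icc 1 (j - i), (-1 : ℚ) ^ (n + 1) / n * ((M.plus - 1) ^ n) i j
  rw [h, Nat.add_sub_add_right]
  exact sum_congr rfl fun n _ => by rw [Tri.plus_pow]

/-! ### Iteration matrices -/

theorem coeff_pow_eq_zero_of_lt {f : ℚ⟦X⟧} (hf : PowerSeries.constantCoeff f = 0) {i j : ℕ}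
    (h : j < i) : PowerSeries.coeff j (f ^ i) = 0 :=
  PowerSeries.X_pow_dvd_iff.1 (pow_dvd_pow_of_dvd (PowerSeries.X_dvd_iff.2 hf) i) j h

theorem iterationMatrix_apply {f : ℚ⟦X⟧} (hf : PowerSeries.constantCoeff f = 0) (i j : ℕ) :
    iterationMatrix f i j = (j ! : ℚ) / (i ! : ℚ) * PowerSeries.coeff j (f ^ i) := by
  change (if i ≤ j then _ else (0 : ℚ)) = _
  split_ifs with h
  · rfl
  · rw [coeff_pow_eq_zero_of_lt hf (not_le.1 h), mul_zero]

theorem iterationMatrix_X : iterationMatrix PowerSeries.X = 1 := by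
  ext i j _
  rw [iterationMatrix_apply (by simp), PowerSeries.coeff_X_pow, IncidenceAlgebra.one_apply]
  rcases eq_or_ne i j with rfl | h
  · simp [div_self, Nat.factorial_ne_zero]
  · simp [h, h.symm]

theorem iterationMatrix_mul {f g : ℚ⟦X⟧} (hf : PowerSeries.constantCoeff f = 0)
    (hg : PowerSeries.constantCoeff g = 0) :
    iterationMatrix g * iterationMatrix f = iterationMatrix (g.subst f) := by
  have hs : PowerSeries.HasSubst f := PowerSeries.HasSubst.of_constantCoeff_zero' hf
  ext i j _
  rw [iterationMatrix_apply (PowerSeries.constantCoeff_subst_eq_zero hf g hg),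
    ← PowerSeries.subst_pow hs, PowerSeries.coeff_subst' hs,
    finsum_eq_sum_of_support_subset (s := Icc i j), IncidenceAlgebra.mul_apply, mul_sum]
  · refine sum_congr rfl fun k _ => ?_
    rw [iterationMatrix_apply hf, iterationMatrix_apply hg, smul_eq_mul]
    have := Nat.factorial_ne_zero k
    field_simp
  · intro k hk
    rw [Function.mem_support, smul_eq_mul] at hk
    rw [coe_Icc, Set.mem_Icc]
    constructor <;> by_contra h <;> refine hk ?_
    · rw [coeff_pow_eq_zero_of_lt hg (not_le.1 h), zero_mul]
    · rw [coeff_pow_eq_zero_of_lt hf (not_le.1 h), mul_zero]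

theorem exists_iterationMatrix_pow {f : ℚ⟦X⟧} (hf : PowerSeries.constantCoeff f = 0) (k : ℕ) :
    ∃ g : ℚ⟦X⟧, PowerSeries.constantCoeff g = 0 ∧ iterationMatrix f ^ k = iterationMatrix g := by
  induction k with
  | zero => exact ⟨PowerSeries.X, by simp, by rw [pow_zero, iterationMatrix_X]⟩
  | succ k ih =>
    obtain ⟨g, hg, h⟩ := ih
    exact ⟨g.subst f, PowerSeries.constantCoeff_subst_eq_zero hf g hg,
      by rw [pow_succ, h, iterationMatrix_mul hf hg]⟩

theorem iterationMatrix_apply_self {f : ℚ⟦X⟧} (hf : PowerSeries.constantCoeff f = 0)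
    (hf1 : PowerSeries.coeff 1 f = 1) (i : ℕ) : iterationMatrix f i i = 1 := by
  obtain ⟨g, rfl⟩ := PowerSeries.X_dvd_iff.2 hf
  have hg : PowerSeries.constantCoeff g = 1 := by
    simpa [PowerSeries.coeff_succ_X_mul] using hf1
  rw [iterationMatrix_apply hf, mul_pow]
  have h := PowerSeries.coeff_X_pow_mul (g ^ i) i 0
  rw [zero_add] at h
  rw [h]
  simp [hg, div_self, Nat.factorial_ne_zero]

/-! ### The logarithm of an iteration matrix -/

/-- The coefficientwise linear term in `t` of a power series over `ℚ[t]`. -/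
noncomputable def linearTerm (G : ℚ[X]⟦X⟧) : ℚ⟦X⟧ :=
  PowerSeries.mk fun n => (PowerSeries.coeff n G).coeff 1

/-- The specialization at `t = k` of a power series over `ℚ[t]`. -/
noncomputable def specialize (k : ℚ) : ℚ[X]⟦X⟧ →+* ℚ⟦X⟧ :=
  PowerSeries.map (Polynomial.evalRingHom k)

/-- Leibniz rule: the linear term is the derivative in `t` at `t = 0`. -/
theorem linearTerm_mul (G H : ℚ[X]⟦X⟧) :
    linearTerm (G * H) = linearTerm G * specialize 0 H + specialize 0 G * linearTerm H := by
  ext n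
  simp only [linearTerm, specialize, PowerSeries.coeff_mk, PowerSeries.coeff_mul, map_add,
    Polynomial.finsetSum_coeff, PowerSeries.coeff_map, Polynomial.coe_evalRingHom]
  rw [← sum_add_distrib]
  refine sum_congr rfl fun p _ => ?_
  rw [Polynomial.mul_coeff_one, ← Polynomial.coeff_zero_eq_eval_zero,
    ← Polynomial.coeff_zero_eq_eval_zero]
  ring

theorem linearTerm_pow (G : ℚ[X]⟦X⟧) (i : ℕ) :
    linearTerm (G ^ i) = (i : ℚ⟦X⟧) * specialize 0 G ^ (i - 1) * linearTerm G := by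
  induction i with
  | zero =>
    ext n
    simp only [linearTerm, pow_zero, PowerSeries.coeff_mk, PowerSeries.coeff_one]
    split_ifs <;> simp [Polynomial.coeff_one]
  | succ i ih =>
    rw [pow_succ, linearTerm_mul, ih, map_pow]
    rcases i with _ | i
    · simp
    · simp only [Nat.add_sub_cancel]
      push_cast
      ring

theorem powerSeries_eq_of_forall_specialize {G H : ℚ[X]⟦X⟧}
    (h : ∀ k : ℕ, specialize k G = specialize k H) : G = H := by
  ext1 n
  refine polynomial_eq_of_forall_eval_natCast fun k => ?_
  simpa [specialize] using congrArg (PowerSeries.coeff n) (h k)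

/-- The power series `(f^{∘t}) ^ i` over `ℚ[t]`. -/
noncomputable def iterateRow (f : ℚ⟦X⟧) (i : ℕ) : ℚ[X]⟦X⟧ :=
  PowerSeries.mk fun j => Polynomial.C ((i ! : ℚ) / (j ! : ℚ)) * (iterationMatrix f).powPoly i j

section

variable {f : ℚ⟦X⟧} (hf : PowerSeries.constantCoeff f = 0) (hf1 : PowerSeries.coeff 1 f = 1)

include hf hf1

theorem specialize_iterateRow {k : ℕ} {g : ℚ⟦X⟧} (hg : PowerSeries.constantCoeff g = 0)
    (h : iterationMatrix f ^ k = iterationMatrix g) (i : ℕ) :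
    specialize k (iterateRow f i) = g ^ i := by
  ext j
  simp only [specialize, iterateRow, PowerSeries.coeff_map, PowerSeries.coeff_mk,
    Polynomial.coe_evalRingHom, Polynomial.eval_mul, Polynomial.eval_C]
  rw [Tri.powPoly_eval (iterationMatrix_apply_self hf hf1), h, iterationMatrix_apply hg]
  have := Nat.factorial_ne_zero i
  have := Nat.factorial_ne_zero j
  field_simp

/-- At `t = k` both sides are the `i`-th power of the same series `g`, where `[f]^k = [g]`. -/
theorem iterateRow_eq_pow (i : ℕ) : iterateRow f i = iterateRow f 1 ^ i := by
  refine powerSeries_eq_of_forall_specialize fun k => ?_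
  obtain ⟨g, hg, h⟩ := exists_iterationMatrix_pow hf k
  rw [map_pow, specialize_iterateRow hf hf1 hg h, specialize_iterateRow hf hf1 hg h, pow_one]

theorem log_iterationMatrix_apply (i j : ℕ) :
    (iterationMatrix f).log i j = (j ! : ℚ) / (i ! : ℚ) *
      PowerSeries.coeff j ((i : ℚ⟦X⟧) * PowerSeries.X ^ (i - 1) * linearTerm (iterateRow f 1)) := by
  have h0 : specialize 0 (iterateRow f 1) = PowerSeries.X := by
    have := specialize_iterateRow hf hf1 (k := 0) (g := PowerSeries.X) (by simp)
      (by rw [pow_zero, iterationMatrix_X]) 1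
    simpa using this
  rw [← h0, ← linearTerm_pow, ← iterateRow_eq_pow hf hf1, linearTerm, PowerSeries.coeff_mk,
    iterateRow, PowerSeries.coeff_mk, Polynomial.coeff_C_mul, Tri.coeff_one_powPoly]
  have := Nat.factorial_ne_zero i
  have := Nat.factorial_ne_zero j
  field_simp

theorem isIterativeLog_linearTerm : IsIterativeLog f (linearTerm (iterateRow f 1)) := by
  have hlog : ∀ j, (iterationMatrix f).log 1 j =
      (j ! : ℚ) * PowerSeries.coeff j (linearTerm (iterateRow f 1)) := fun j => by
    simpa using log_iterationMatrix_apply hf hf1 1 j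
  refine ⟨PowerSeries.X_pow_dvd_iff.2 fun m hm => ?_, ?_⟩
  · have h := hlog m
    have hz : (iterationMatrix f).log 1 m = 0 := by
      change ∑ n ∈ Icc 1 (m - 1), _ = (0 : ℚ)
      rw [Nat.sub_eq_zero_of_le (by omega)]
      simp
    rw [hz] at h
    simpa [Nat.factorial_ne_zero] using h.symm
  · ext i j hij
    change _ = if i ≤ j then (j ! : ℚ) / (i ! : ℚ) * i * PowerSeries.coeff (j - i + 1) _ else 0
    rw [if_pos hij, log_iterationMatrix_apply hf hf1, mul_assoc, mul_assoc]
    congr 1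
    rw [← nsmul_eq_mul, map_nsmul, nsmul_eq_mul]
    rcases i with _ | i
    · simp
    · congr 1
      have := PowerSeries.coeff_X_pow_mul (linearTerm (iterateRow f 1)) i (j - (i + 1) + 1)
      rwa [show j - (i + 1) + 1 + i = j by omega] at this

end

theorem infinitesimalMatrix_apply_of_le (h : ℚ⟦X⟧) {i j : ℕ} (hij : i ≤ j) :
    infinitesimalMatrix h i j = (j ! : ℚ) / (i ! : ℚ) * i * PowerSeries.coeff (j - i + 1) h :=
  if_pos hij

theorem IsIterativeLog.coeff_zero {f h : ℚ⟦X⟧} (hh : IsIterativeLog f h) :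
    PowerSeries.coeff 0 h = 0 :=
  PowerSeries.X_pow_dvd_iff.1 hh.1 0 (by norm_num)

theorem IsIterativeLog.log_apply {f h : ℚ⟦X⟧} (hh : IsIterativeLog f h) {n : ℕ} (hn : 1 ≤ n) :
    (iterationMatrix f).log 1 n = (n ! : ℚ) * PowerSeries.coeff n h := by
  rw [hh.2, infinitesimalMatrix_apply_of_le h hn, Nat.sub_add_cancel hn]
  simp

theorem IsIterativeLog.unique {f h h' : ℚ⟦X⟧} (hh : IsIterativeLog f h)
    (hh' : IsIterativeLog f h') : h = h' := by
  ext n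
  rcases Nat.eq_zero_or_pos n with rfl | hn
  · rw [hh.coeff_zero, hh'.coeff_zero]
  · have := (hh.log_apply hn).symm.trans (hh'.log_apply hn)
    simpa [Nat.factorial_ne_zero] using this

/-! ### Stirling numbers -/

/-- Differentiating `(e^z - 1)^(i+1)` reproduces the Stirling recurrence. -/
theorem coeff_exp_sub_one_pow (i j : ℕ) :
    PowerSeries.coeff j ((PowerSeries.exp ℚ - 1) ^ i) =
      (i ! : ℚ) / (j ! : ℚ) * (Nat.stirlingSecond j i : ℚ) := by
  induction j generalizing i with
  | zero =>
    rcases i with _ | i <;> simp [PowerSeries.coeff_zero_eq_constantCoeff]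
  | succ j ih =>
    rcases i with _ | i
    · simp [PowerSeries.coeff_one]
    · have hd : PowerSeries.derivative ℚ ((PowerSeries.exp ℚ - 1) ^ (i + 1)) =
          ((i + 1 : ℕ) : ℚ) •
            ((PowerSeries.exp ℚ - 1) ^ (i + 1) + (PowerSeries.exp ℚ - 1) ^ i) := by
        rw [Derivation.leibniz_pow, map_sub, PowerSeries.derivative_exp, Derivation.map_one_eq_zero,
          Nat.add_sub_cancel, smul_eq_mul, ← Nat.cast_smul_eq_nsmul ℚ]
        congr 1
        ring
      have h := congrArg (PowerSeries.coeff j) hd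
      rw [PowerSeries.coeff_derivative, map_smul, map_add, ih, ih, smul_eq_mul] at h
      rw [Nat.stirlingSecond_succ_succ]
      have h1 : (j : ℚ) + 1 ≠ 0 := by positivity
      rw [← eq_div_iff h1] at h
      rw [h, Nat.factorial_succ, Nat.factorial_succ]
      have := Nat.factorial_ne_zero j
      push_cast
      field_simp

theorem stirlingMatrix_apply (i j : ℕ) : stirlingMatrix i j = (Nat.stirlingSecond j i : ℚ) := rfl

theorem stirlingMatrix_apply_self (i : ℕ) : stirlingMatrix i i = 1 := by
  rw [stirlingMatrix_apply, Nat.stirlingSecond_self, Nat.cast_one]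

theorem iterationMatrix_exp_sub_one : iterationMatrix (PowerSeries.exp ℚ - 1) = stirlingMatrix := by
  ext i j _
  rw [iterationMatrix_apply (by simp), coeff_exp_sub_one_pow, stirlingMatrix_apply]
  have := Nat.factorial_ne_zero i
  have := Nat.factorial_ne_zero j
  field_simp

theorem existsUnique_isIterativeLog_exp_sub_one :
    ∃! h : ℚ⟦X⟧, IsIterativeLog (PowerSeries.exp ℚ - 1) h := by
  have h := isIterativeLog_linearTerm (f := PowerSeries.exp ℚ - 1) (by simp)
    (by simp [PowerSeries.coeff_one])
  exact ⟨_, h, fun h' hh' => hh'.unique h⟩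

section

variable {h : ℚ⟦X⟧} (hh : IsIterativeLog (PowerSeries.exp ℚ - 1) h) {c : ℕ → ℚ}
  (hc : ∀ n, c n = (n ! : ℚ) * PowerSeries.coeff n h)

include hh hc

theorem log_stirlingMatrix_one_apply {n : ℕ} (hn : 1 ≤ n) : stirlingMatrix.log 1 n = c n := by
  rw [hc, ← iterationMatrix_exp_sub_one, hh.log_apply hn]

theorem log_stirlingMatrix_succ_apply {i j : ℕ} (hij : i ≤ j) :
    stirlingMatrix.log (i + 1) (j + 1) = c (j - i + 1) * ((j + 1).choose i : ℚ) := by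
  rw [← iterationMatrix_exp_sub_one, hh.2, infinitesimalMatrix_apply_of_le h (by omega), hc,
    Nat.cast_choose ℚ (show i ≤ j + 1 by omega), Nat.add_sub_add_right,
    show j + 1 - i = j - i + 1 by omega, Nat.factorial_succ i]
  have := Nat.factorial_ne_zero i
  have := Nat.factorial_ne_zero (j - i + 1)
  push_cast
  field_simp

/-- Entry `(1, n)` of `log S * S = S * log S`, where row `1` of `S` is constantly `1` from column
`1` on. It serves as a recurrence for `c`. -/
theorem sum_mul_stirlingSecond_eq (n : ℕ) :
    ∑ k ∈ Icc 1 n, c k * (Nat.stirlingSecond n k : ℚ) =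
      ∑ k ∈ range n, c (n - k) * (n.choose k : ℚ) := by
  rcases n with _ | n
  · simp
  have h1 := congrArg (fun M : Tri => M 1 (n + 1)) (Tri.mul_log_comm stirlingMatrix_apply_self)
  simp only [IncidenceAlgebra.mul_apply] at h1
  rw [sum_congr rfl fun k hk => by
    rw [← log_stirlingMatrix_one_apply hh hc (mem_Icc.1 hk).1, ← stirlingMatrix_apply], ← h1,
    range_eq_Ico]
  have h2 := sum_Ico_add' (fun k => stirlingMatrix 1 k * stirlingMatrix.log k (n + 1)) 0 (n + 1) 1
  rw [show Icc 1 (n + 1) = Ico (0 + 1) (n + 1 + 1) by ext; simp, ← h2]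
  refine sum_congr rfl fun k hk => ?_
  rw [mem_Ico] at hk
  rw [log_stirlingMatrix_succ_apply hh hc (by omega), stirlingMatrix_apply,
    Nat.stirlingSecond_one_right, Nat.cast_one, one_mul, show n - k + 1 = n + 1 - k by omega]

end

/-! ### The first terms -/

section

variable {h : ℚ⟦X⟧} (hh : IsIterativeLog (PowerSeries.exp ℚ - 1) h) {c : ℕ → ℚ}
  (hc : ∀ n, c n = (n ! : ℚ) * PowerSeries.coeff n h)

include hh hc

theorem ofFn_eq_first_terms : (List.ofFn fun i : Fin 13 => c (i + 1)) =
    [0, 1, -1 / 2, 1 / 2, -2 / 3, 11 / 12, -3 / 4, -11 / 6, 29 / 4, 493 / 12, -2711 / 6,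
      -12406 / 15, 2636317 / 60] := by
  have c1 : c 1 = 0 := by
    rw [hc, PowerSeries.X_pow_dvd_iff.1 hh.1 1 (by norm_num), mul_zero]
  have c2 : c 2 = 1 := by
    rw [← log_stirlingMatrix_one_apply hh hc (by norm_num : 1 ≤ 2)]
    change ∑ n ∈ Icc (1 : ℕ) 1, (-1 : ℚ) ^ (n + 1) / n * ((stirlingMatrix - 1) ^ n) 1 2 = 1
    simp [stirlingMatrix_apply, Nat.stirlingSecond]
  -- In `e n` the term `c n` cancels, and `c (n - 1)` has coefficient `n(n-1)/2` on the left and `n`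
  -- on the right. These differ for `n ≥ 4`, so `e n` determines `c (n - 1)`; for `n = 3` they
  -- agree, which is why `c 2` is read off from the logarithm directly.
  have e := sum_mul_stirlingSecond_eq hh hc
  have c3 : c 3 = -1 / 2 := by
    have := e 4
    simp [sum_Icc_succ_top, sum_range_succ, Nat.stirlingSecond, Nat.choose, c1, c2] at this
    linarith
  have c4 : c 4 = 1 / 2 := by
    have := e 5
    simp [sum_Icc_succ_top, sum_range_succ, Nat.stirlingSecond, Nat.choose, c1, c2, c3] at this
    linarith
  have c5 : c 5 = -2 / 3 := by
    have := e 6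
    simp [sum_Icc_succ_top, sum_range_succ, Nat.stirlingSecond, Nat.choose, c1, c2, c3, c4] at this
    linarith
  have c6 : c 6 = 11 / 12 := by
    have := e 7
    simp [sum_Icc_succ_top, sum_range_succ, Nat.stirlingSecond, Nat.choose, c1, c2, c3, c4, c5]
      at this
    linarith
  have c7 : c 7 = -3 / 4 := by
    have := e 8
    simp [sum_Icc_succ_top, sum_range_succ, Nat.stirlingSecond, Nat.choose, c1, c2, c3, c4, c5, c6]
      at this
    linarith
  have c8 : c 8 = -11 / 6 := by
    have := e 9
    simp [sum_Icc_succ_top, sum_range_succ, Nat.stirlingSecond, Nat.choose, c1, c2, c3, c4, c5, c6,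
      c7] at this
    linarith
  have c9 : c 9 = 29 / 4 := by
    have := e 10
    simp [sum_Icc_succ_top, sum_range_succ, Nat.stirlingSecond, Nat.choose, c1, c2, c3, c4, c5, c6,
      c7, c8] at this
    linarith
  have c10 : c 10 = 493 / 12 := by
    have := e 11
    simp [sum_Icc_succ_top, sum_range_succ, Nat.stirlingSecond, Nat.choose, c1, c2, c3, c4, c5, c6,
      c7, c8, c9] at this
    linarith
  have c11 : c 11 = -2711 / 6 := by
    have := e 12
    simp [sum_Icc_succ_top, sum_range_succ, Nat.stirlingSecond, Nat.choose, c1, c2, c3, c4, c5, c6,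
      c7, c8, c9, c10] at this
    linarith
  have c12 : c 12 = -12406 / 15 := by
    have := e 13
    simp [sum_Icc_succ_top, sum_range_succ, Nat.stirlingSecond, Nat.choose, c1, c2, c3, c4, c5, c6,
      c7, c8, c9, c10, c11] at this
    linarith
  have c13 : c 13 = 2636317 / 60 := by
    have := e 14
    simp [sum_Icc_succ_top, sum_range_succ, Nat.stirlingSecond, Nat.choose, c1, c2, c3, c4, c5, c6,
      c7, c8, c9, c10, c11, c12] at this
    linarith
  simp [List.ofFn_succ, c1, c2, c3, c4, c5, c6, c7, c8, c9, c10, c11, c12, c13, Fin.succ]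

end

/-! ### The sum over chains -/

/-- The sum of the products of Stirling numbers over the chains with `k + 1` members. -/
def chainWeight (n k : ℕ) : ℚ :=
  ∑ m ∈ chains n k, ∏ i : Fin k, (Nat.stirlingSecond (m i.succ) (m i.castSucc) : ℚ)

theorem mem_chains {n k : ℕ} {m : Fin (k + 1) → ℕ} :
    m ∈ chains n k ↔ (∀ i, 2 ≤ m i ∧ m i ≤ n) ∧ (∀ i : Fin k, m i.castSucc < m i.succ) ∧
      m (Fin.last k) = n := by
  simp [chains]

theorem chainWeight_zero (n : ℕ) : chainWeight n 0 = if 2 ≤ n then 1 else 0 := by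
  have h : chains n 0 = if 2 ≤ n then {fun _ => n} else ∅ := by
    ext m
    rw [mem_chains]
    split_ifs with hn
    · rw [mem_singleton]
      constructor
      · rintro ⟨-, -, h⟩
        funext i
        rw [← h, Fin.fin_one_eq_zero i]
        rfl
      · rintro rfl
        simp [hn]
    · simp only [notMem_empty, iff_false]
      rintro ⟨h, -, -⟩
      have := h 0
      omega
  rw [chainWeight, h]
  split_ifs <;> simp

theorem snoc_mem_chains_iff {n k : ℕ} {m : Fin (k + 1) → ℕ} :
    (Fin.snoc m n : Fin (k + 2) → ℕ) ∈ chains n (k + 1) ↔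
      m (Fin.last k) < n ∧ m ∈ chains (m (Fin.last k)) k := by
  have h1 : (∀ i, 2 ≤ (Fin.snoc m n : Fin (k + 2) → ℕ) i ∧ (Fin.snoc m n : Fin (k + 2) → ℕ) i ≤ n) ↔
      (∀ i, 2 ≤ m i ∧ m i ≤ n) ∧ 2 ≤ n := by
    rw [Fin.forall_fin_succ']
    simp only [Fin.snoc_castSucc, Fin.snoc_last, le_refl, and_true]
  have h2 : (∀ i : Fin (k + 1), (Fin.snoc m n : Fin (k + 2) → ℕ) i.castSucc <
      (Fin.snoc m n : Fin (k + 2) → ℕ) i.succ) ↔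
      (∀ i : Fin k, m i.castSucc < m i.succ) ∧ m (Fin.last k) < n := by
    rw [Fin.forall_fin_succ']
    simp only [Fin.snoc_castSucc, Fin.succ_castSucc, Fin.succ_last, Fin.snoc_last]
  rw [mem_chains, mem_chains, h1, h2, Fin.snoc_last]
  constructor
  · rintro ⟨⟨h3, -⟩, ⟨h4, h5⟩, -⟩
    refine ⟨h5, fun i => ⟨(h3 i).1, ?_⟩, h4, rfl⟩
    exact (Fin.strictMono_iff_lt_succ.2 h4).monotone (Fin.le_last i)
  · rintro ⟨h3, h4, h5, -⟩
    exact ⟨⟨fun i => ⟨(h4 i).1, (h4 i).2.trans h3.le⟩, (h4 (Fin.last k)).1.trans h3.le⟩,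
      ⟨h5, h3⟩, rfl⟩

/-- Deleting the last member `n` of a chain leaves a chain ending at some `l < n`. -/
theorem chainWeight_succ (n k : ℕ) :
    chainWeight n (k + 1) = ∑ l ∈ range n, chainWeight l k * (Nat.stirlingSecond n l : ℚ) := by
  simp only [chainWeight, sum_mul]
  rw [sum_sigma']
  refine sum_bij' (fun m _ => ⟨m (Fin.last k).castSucc, Fin.init m⟩) (fun p _ => Fin.snoc p.2 n)
    ?_ ?_ ?_ ?_ ?_
  · intro m hm
    have hl := (mem_chains.1 hm).2.2
    have : Fin.snoc (Fin.init m) n = m := by rw [← hl]; exact Fin.snoc_init_self m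
    rw [← this, snoc_mem_chains_iff] at hm
    simpa [Fin.init] using hm
  · rintro ⟨l, m⟩ hp
    rw [mem_sigma, mem_range] at hp
    have hl := (mem_chains.1 hp.2).2.2
    dsimp only at hp hl ⊢
    rw [snoc_mem_chains_iff, hl]
    exact hp
  · intro m hm
    have hl := (mem_chains.1 hm).2.2
    rw [← hl]
    exact Fin.snoc_init_self m
  · rintro ⟨l, m⟩ hp
    rw [mem_sigma, mem_range] at hp
    have hl := (mem_chains.1 hp.2).2.2
    dsimp only at hl
    subst hl
    simp
  · intro m hm
    have hl := (mem_chains.1 hm).2.2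
    rw [Fin.prod_univ_castSucc]
    simp only [Fin.init, Fin.succ_last, hl, Fin.castSucc_succ]

/-- The first step of a path out of `1` has weight `1` and goes to some `n₁ ≥ 2`; so `k + 1` factors
leave only `k` Stirling numbers. -/
theorem stirlingMatrix_sub_one_pow_apply (k n : ℕ) :
    ((stirlingMatrix - 1) ^ (k + 1)) 1 n = chainWeight n k := by
  induction k generalizing n with
  | zero =>
    rw [zero_add, pow_one, chainWeight_zero, IncidenceAlgebra.sub_apply, stirlingMatrix_apply,
      IncidenceAlgebra.one_apply]
    rcases n with _ | _ | n
    · simp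
    · simp [Nat.stirlingSecond_self]
    · simp [Nat.stirlingSecond_one_right]
  | succ k ih =>
    rw [pow_succ, IncidenceAlgebra.mul_apply, chainWeight_succ]
    simp only [ih, IncidenceAlgebra.sub_apply, stirlingMatrix_apply, IncidenceAlgebra.one_apply]
    have h0 : chainWeight 0 k = 0 := by
      rw [← ih]
      exact IncidenceAlgebra.apply_eq_zero_of_not_le (by norm_num) _
    -- The index sets differ in `l = n`, where the diagonal entry of `S - 1` vanishes, and in `l =
    -- 0`, where there is no chain.
    refine sum_congr_of_eq_on_inter ?_ ?_ ?_
    · intro l hl hl'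
      have : l = n := by rw [mem_Icc] at hl; rw [mem_range] at hl'; omega
      simp [this, Nat.stirlingSecond_self]
    · intro l hl hl'
      have : l = 0 := by rw [mem_Icc] at hl'; rw [mem_range] at hl; omega
      rw [this, h0, zero_mul]
    · intro l _ hl
      rw [if_neg (mem_range.1 hl).ne, sub_zero]

theorem log_stirlingMatrix_one_eq_chainSum (n : ℕ) : stirlingMatrix.log 1 n = chainSum n := by
  change ∑ k ∈ Icc 1 (n - 1), (-1 : ℚ) ^ (k + 1) / k * ((stirlingMatrix - 1) ^ k) 1 n = _
  refine sum_congr (by ext; simp; omega) fun k hk => ?_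
  rw [← mul_sum]
  have h := stirlingMatrix_sub_one_pow_apply (k - 1) n
  rw [Nat.sub_add_cancel (mem_Ico.1 hk).1] at h
  rw [h, chainWeight]

/-! ### The numbers `a` -/

theorem coeff_inv_one_sub_C_mul_X (b : ℚ) (m : ℕ) :
    PowerSeries.coeff m (1 - PowerSeries.C b * PowerSeries.X : ℚ⟦X⟧)⁻¹ = b ^ m := by
  have h : (1 - PowerSeries.C b * PowerSeries.X : ℚ⟦X⟧)⁻¹ = PowerSeries.mk fun m => b ^ m := by
    rw [PowerSeries.inv_eq_iff_mul_eq_one (by simp)]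
    ext n
    rcases n with _ | n
    · simp [PowerSeries.coeff_one]
    · rw [mul_sub, mul_one, map_sub, PowerSeries.coeff_mk, mul_left_comm, PowerSeries.coeff_C_mul,
        PowerSeries.coeff_succ_mul_X, PowerSeries.coeff_mk, PowerSeries.coeff_one,
        if_neg n.succ_ne_zero]
      ring
  rw [h, PowerSeries.coeff_mk]

theorem a_eq_sum (d m : ℕ) :
    a d m = ∑ b ∈ range (d + 1),
      (d.choose b : ℚ) * ((-1) ^ (d - b) / (d ! : ℚ)) * ((b : ℚ) + 1) ^ m := by
  rw [a, map_sum, show Icc 1 (d + 1) = Ico (0 + 1) (d + 1 + 1) by ext; simp, range_eq_Ico,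
    ← sum_Ico_add']
  refine sum_congr rfl fun b _ => ?_
  rw [PowerSeries.coeff_C_mul, coeff_inv_one_sub_C_mul_X]
  simp

theorem a_zero_right (d : ℕ) : a d 0 = if d = 0 then 1 else 0 := by
  have h := Int.alternating_sum_range_choose (n := d)
  have h' : a d 0 = ((-1) ^ d / (d ! : ℚ)) *
      ((∑ b ∈ range (d + 1), ((-1) ^ b * d.choose b : ℤ) : ℤ) : ℚ) := by
    rw [a_eq_sum]
    push_cast
    rw [mul_sum]
    refine sum_congr rfl fun b hb => ?_
    have hb' : b ≤ d := by rw [mem_range] at hb; omega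
    obtain ⟨e, rfl⟩ := Nat.exists_eq_add_of_le hb'
    rw [Nat.add_sub_cancel_left, pow_add, pow_zero]
    have : ((-1 : ℚ) ^ b) * (-1) ^ b = 1 := by rw [← mul_pow]; norm_num
    linear_combination (-((b + e).choose b : ℚ) * (-1) ^ e / ((b + e)! : ℚ)) * this
  rw [h', h]
  rcases d with _ | d <;> simp

theorem a_zero_left (m : ℕ) : a 0 m = 1 := by
  simp [a_eq_sum]

/-- Split one factor `b + 1` as `(d + 2) + (b + 1 - (d + 2))`. The second part kills `b = d + 1`
and, by absorption into the binomial coefficient, lowers `d + 1` to `d`. -/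
theorem a_succ_succ (d m : ℕ) : a (d + 1) (m + 1) = (d + 2) * a (d + 1) m + a d m := by
  have h : a d m = ∑ b ∈ range (d + 2),
      ((b : ℚ) + 1 - (d + 2)) * (((d + 1).choose b : ℚ) *
        ((-1) ^ (d + 1 - b) / ((d + 1)! : ℚ)) * ((b : ℚ) + 1) ^ m) := by
    rw [sum_range_succ, a_eq_sum]
    push_cast
    rw [show ((d : ℚ) + 1 + 1 - (d + 2)) = 0 by ring, zero_mul, add_zero]
    refine sum_congr rfl fun b hb => ?_
    have hb' : b ≤ d := by rw [mem_range] at hb; omega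
    obtain ⟨e, rfl⟩ := Nat.exists_eq_add_of_le hb'
    have h1 : ((b + e + 1).choose b : ℚ) * (e + 1) = (b + e + 1) * (b + e).choose b := by
      have := Nat.choose_mul_succ_eq (b + e) b
      rw [show b + e + 1 - b = e + 1 by omega] at this
      have := congrArg (Nat.cast : ℕ → ℚ) this
      push_cast at this
      linarith
    rw [show b + e + 1 - b = e + 1 by omega, Nat.add_sub_cancel_left, Nat.factorial_succ]
    have := Nat.factorial_ne_zero (b + e)
    have h2 : (b : ℚ) + e + 1 ≠ 0 := by positivity
    push_cast
    field_simp
    linear_combination (-(-1) ^ e : ℚ) * h1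
  rw [h, a_eq_sum, a_eq_sum, mul_sum, ← sum_add_distrib]
  refine sum_congr rfl fun b _ => ?_
  ring

theorem a_eq_stirlingSecond (d m : ℕ) : a d m = (Nat.stirlingSecond (m + 1) (d + 1) : ℚ) := by
  induction m generalizing d with
  | zero =>
    rw [a_zero_right]
    rcases d with _ | d <;> simp [Nat.stirlingSecond]
  | succ m ih =>
    rcases d with _ | d
    · rw [a_zero_left, zero_add, Nat.stirlingSecond_one_right, Nat.cast_one]
    · rw [a_succ_succ, ih, ih, Nat.stirlingSecond_succ_succ (m + 1) (d + 1)]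
      push_cast
      ring

/-! ### Linear coefficients of the operators -/

/-- The coefficient of `t_m`. -/
noncomputable def linCoeff (m : ℕ) (f : R) : ℚ[X] := MvPowerSeries.coeff (Finsupp.single m 1) f

theorem linCoeff_formalSum {ι : Type} (m : ℕ) (F : ι → R) :
    linCoeff m (formalSum F) = ∑ᶠ i, linCoeff m (F i) := rfl

theorem linCoeff_rat_smul (m : ℕ) (q : ℚ) (f : R) : linCoeff m (q • f) = q • linCoeff m f := rfl

theorem linCoeff_smul (m : ℕ) (p : ℚ[X]) (f : R) : linCoeff m (p • f) = p * linCoeff m f := rfl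

theorem linCoeff_X (m n : ℕ) : linCoeff m (MvPowerSeries.X n : R) = if m = n then 1 else 0 := by
  classical
  rw [linCoeff, MvPowerSeries.coeff_X]
  simp [Finsupp.single_left_inj]

theorem linCoeff_X_mul (m n : ℕ) (f : R) :
    linCoeff m (MvPowerSeries.X n * f) = if m = n then MvPowerSeries.coeff 0 f else 0 := by
  classical
  rw [linCoeff, MvPowerSeries.X, MvPowerSeries.coeff_monomial_mul]
  rcases eq_or_ne m n with rfl | h
  · simp
  · rw [if_neg, if_neg h]
    intro hle
    have := hle n
    simp [h] at this

theorem coeff_zero_pderiv (n : ℕ) (f : R) :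
    MvPowerSeries.coeff 0 (MvPowerSeries.pderiv ℚ[X] n f) = linCoeff n f := by
  rw [MvPowerSeries.coeff_pderiv, linCoeff]
  simp

/-- The linear part of `t_{n+k} ∂_n f` only sees the constant term of `∂_n f`, a linear coefficient
of `f`. Linear coefficients thus transform among themselves. -/
theorem linCoeff_smallL (α : ℕ → ℕ → ℚ) (k m : ℕ) (f : R) :
    linCoeff m (smallL α k f) = if k ≤ m then α (m - k) m • linCoeff (m - k) f else 0 := by
  rw [smallL, linCoeff_formalSum]
  simp only [linCoeff_rat_smul, linCoeff_X_mul, coeff_zero_pderiv]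
  split_ifs with h
  · rw [finsum_eq_single _ (m - k), Nat.sub_add_cancel h, if_pos rfl]
    intro n hn
    rw [if_neg (by omega), smul_zero]
  · rw [finsum_eq_zero_of_forall_eq_zero]
    intro n
    rw [if_neg (by omega), smul_zero]

theorem linCoeff_boldSmallL (α : ℕ → ℕ → ℚ) (m : ℕ) (f : R) :
    linCoeff m (boldSmallL α f) =
      ∑ n ∈ range m, Polynomial.X ^ (m - n) * (α n m • linCoeff n f) := by
  rw [boldSmallL, linCoeff_formalSum]
  simp only [linCoeff_smul, linCoeff_smallL]
  rw [finsum_eq_sum_of_support_subset (s := range m), ← sum_range_reflect]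
  · refine sum_congr rfl fun n hn => ?_
    rw [mem_range] at hn
    rw [show m - 1 - n + 1 = m - n by omega, if_pos (by omega), show m - (m - n) = n by omega]
  · intro k hk
    rw [Function.mem_support] at hk
    rw [coe_range, Set.mem_Iio]
    by_contra h
    exact hk (by rw [if_neg (by omega), mul_zero])

theorem strictMatrix_apply (α : ℕ → ℕ → ℚ) (i j : ℕ) :
    strictMatrix α i j = if i < j then α i j else 0 := rfl

theorem linCoeff_boldSmallL_iterate (α : ℕ → ℕ → ℚ) (i N m : ℕ) :
    linCoeff m ((boldSmallL α)^[N] (MvPowerSeries.X i)) =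
      Polynomial.C ((strictMatrix α ^ N) i m) * Polynomial.X ^ (m - i) := by
  induction N generalizing m with
  | zero =>
    rw [Function.iterate_zero_apply, linCoeff_X, pow_zero, IncidenceAlgebra.one_apply]
    rcases eq_or_ne m i with rfl | h
    · simp
    · simp [h, h.symm]
  | succ N ih =>
    rw [Function.iterate_succ_apply', linCoeff_boldSmallL, pow_succ, IncidenceAlgebra.mul_apply,
      map_sum, sum_mul]
    refine sum_congr_of_eq_on_inter ?_ ?_ ?_
    · intro n hn hn'
      rw [mem_range] at hn
      rw [mem_Icc] at hn'
      rw [ih, IncidenceAlgebra.apply_eq_zero_of_not_le (by omega)]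
      simp
    · intro n hn hn'
      rw [mem_range] at hn'
      rw [strictMatrix_apply, if_neg hn', mul_zero, map_zero, zero_mul]
    · intro n hn hn'
      rw [mem_range] at hn
      rw [mem_Icc] at hn'
      rw [ih, strictMatrix_apply, if_pos hn, Polynomial.smul_eq_C_mul, Polynomial.C_mul,
        show m - i = (m - n) + (n - i) by omega, pow_add]
      ring

theorem strictMatrix_apply_self (α : ℕ → ℕ → ℚ) (i : ℕ) : strictMatrix α i i = 0 :=
  if_neg (lt_irrefl i)

theorem linCoeff_opExp_boldSmallL (α : ℕ → ℕ → ℚ) (i m : ℕ) :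
    linCoeff m (opExp (boldSmallL α) (MvPowerSeries.X i)) =
      Polynomial.C (∑ n ∈ range (m - i + 1), 1 / (n ! : ℚ) * (strictMatrix α ^ n) i m) *
        Polynomial.X ^ (m - i) := by
  rw [opExp, linCoeff_formalSum]
  simp only [linCoeff_rat_smul, linCoeff_boldSmallL_iterate]
  -- A `finsum` of infinite support would be `0` by convention; nilpotency of the strict matrix
  -- bounds the support.
  rw [finsum_eq_sum_of_support_subset (s := range (m - i + 1)), map_sum, sum_mul]
  · refine sum_congr rfl fun n _ => ?_
    rw [Polynomial.smul_eq_C_mul, Polynomial.C_mul, mul_assoc]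
  · intro n hn
    rw [Function.mem_support] at hn
    rw [coe_range, Set.mem_Iio]
    by_contra h
    refine hn ?_
    rw [Tri.pow_apply_eq_zero (strictMatrix_apply_self α) (by omega)]
    simp

theorem L_zero (f : R) : L 0 f = f := by
  have : Unique (LIndex 0) :=
    { default := ⟨0, le_rfl, Fin.elim0, fun i => i.elim0, by simp, Fin.elim0⟩
      uniq := by
        rintro ⟨r, hr, ks, _, _, ns⟩
        obtain rfl := Nat.le_zero.1 hr
        congr 1 <;> exact Subsingleton.elim _ _ }
  have key : ∀ p : LIndex 0, ((1 / (p.r ! : ℚ)) * ∏ i, a (p.ns i) (p.ns i + p.ks i)) •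
      ((∏ i, (MvPowerSeries.X (p.ns i + p.ks i) : R)) * iteratedPartial p.ns f) = f := by
    rintro ⟨r, hr, ks, _, _, ns⟩
    obtain rfl := Nat.le_zero.1 hr
    simp [iteratedPartial]
  rw [L, funext key]
  ext1 e
  exact finsum_unique fun _ : LIndex 0 => MvPowerSeries.coeff e f

/-- The index of the term of `L_k` with the single derivative `∂_n`. -/
def LIndex.single {k : ℕ} (hk : 0 < k) (n : ℕ) : LIndex k where
  r := 1
  r_le := hk
  ks _ := k
  ks_pos _ := hk
  ks_sum := by simp
  ns _ := n

/-- As `k > 0`, `r = 0` is impossible; for `r = 1` only `∂_i` sees `t_i`; for `r ≥ 2` the term is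
divisible by a product of two variables and has no linear part. -/
theorem linCoeff_L_X {k : ℕ} (hk : 0 < k) (m i : ℕ) :
    linCoeff m (L k (MvPowerSeries.X i)) = if m = i + k then Polynomial.C (a i (i + k)) else 0 := by
  rw [L, linCoeff_formalSum, finsum_eq_single _ (LIndex.single hk i)]
  · rw [linCoeff_rat_smul]
    change ((1 / ((1 ! : ℕ) : ℚ)) * ∏ _ : Fin 1, a i (i + k)) •
      linCoeff m ((∏ _ : Fin 1, (MvPowerSeries.X (i + k) : R)) *
        MvPowerSeries.pderiv ℚ[X] i (MvPowerSeries.X i)) = _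
    rw [Fin.prod_univ_one, Fin.prod_univ_one, linCoeff_X_mul, coeff_zero_pderiv, linCoeff_X,
      if_pos (rfl : i = i)]
    split_ifs <;> simp [Polynomial.smul_eq_C_mul]
  · rintro ⟨r, hr, ks, hks, hsum, ns⟩ hne
    rw [linCoeff_rat_smul]
    dsimp only
    rcases r with _ | _ | r
    · simp at hsum
      omega
    · have hk0 : ks = fun _ => k := by
        funext j
        rw [Fin.fin_one_eq_zero j]
        simpa using hsum
      have hn : ns 0 ≠ i := by
        rintro rfl
        refine hne ?_
        subst hk0
        have : ns = fun _ => ns 0 := by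
          funext j
          rw [Fin.fin_one_eq_zero j]
        unfold LIndex.single
        congr 1
      have hz : linCoeff m ((∏ j : Fin (0 + 1), (MvPowerSeries.X (ns j + ks j) : R)) *
          iteratedPartial ns (MvPowerSeries.X i)) = 0 := by
        rw [show iteratedPartial ns (MvPowerSeries.X i) =
          MvPowerSeries.pderiv ℚ[X] (ns 0) (MvPowerSeries.X i : R) from rfl]
        rw [Fin.prod_univ_one, linCoeff_X_mul, coeff_zero_pderiv, linCoeff_X, if_neg hn, ite_self]
      rw [hz, smul_zero]
    · rw [Fin.prod_univ_succ (n := r + 1) (f := fun j => (MvPowerSeries.X (ns j + ks j) : R)),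
        Fin.prod_univ_succ (n := r) (f := fun j => (MvPowerSeries.X (ns j.succ + ks j.succ) : R)),
        mul_assoc, mul_assoc, linCoeff_X_mul, MvPowerSeries.coeff_zero_X_mul, ite_self, smul_zero]

theorem linCoeff_bigL_X {i m : ℕ} (h : i ≤ m) :
    linCoeff m (bigL (MvPowerSeries.X i)) = Polynomial.C (a i m) * Polynomial.X ^ (m - i) := by
  rw [bigL, linCoeff_formalSum, finsum_eq_single _ (m - i), linCoeff_smul]
  · rcases h.eq_or_lt with rfl | hlt
    · rw [Nat.sub_self, L_zero, linCoeff_X, if_pos rfl, a_eq_stirlingSecond,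
        Nat.stirlingSecond_self]
      simp
    · rw [linCoeff_L_X (by omega), if_pos (by omega), show i + (m - i) = m by omega, mul_comm]
  · intro k hk
    rw [linCoeff_smul]
    rcases Nat.eq_zero_or_pos k with rfl | hk0
    · rw [L_zero, linCoeff_X, if_neg (by omega), mul_zero]
    · rw [linCoeff_L_X hk0, if_neg (by omega), mul_zero]

theorem IsShadrinZvonkine.stirlingMatrix_plus_apply {α : ℕ → ℕ → ℚ} (hα : IsShadrinZvonkine α)
    (i j : ℕ) : stirlingMatrix.plus i j =
      ∑ n ∈ range (j - i + 1), 1 / (n ! : ℚ) * (strictMatrix α ^ n) i j := by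
  by_cases hij : i ≤ j
  · have h := congrArg (linCoeff j) (hα (MvPowerSeries.X i))
    rw [linCoeff_bigL_X hij, linCoeff_opExp_boldSmallL] at h
    have h' := Polynomial.C_injective (mul_right_cancel₀ (pow_ne_zero _ Polynomial.X_ne_zero) h)
    rw [← h', a_eq_stirlingSecond]
    rfl
  · rw [IncidenceAlgebra.apply_eq_zero_of_not_le hij]
    refine (sum_eq_zero fun n _ => ?_).symm
    rw [IncidenceAlgebra.apply_eq_zero_of_not_le hij, mul_zero]

theorem IsShadrinZvonkine.strictMatrix_eq {α : ℕ → ℕ → ℚ} (hα : IsShadrinZvonkine α) :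
    strictMatrix α = stirlingMatrix.log.plus := by
  rw [Tri.plus_log,
    Tri.log_eq_of_eq_exp (strictMatrix_apply_self α) hα.stirlingMatrix_plus_apply]

end ShadrinZvonkine

theorem mainTheorem1 :
    (∃! h : ℚ⟦X⟧, ShadrinZvonkine.IsIterativeLog (PowerSeries.exp ℚ - 1) h) ∧
    ∀ h : ℚ⟦X⟧, ShadrinZvonkine.IsIterativeLog (PowerSeries.exp ℚ - 1) h →
    ∀ c : ℕ → ℚ, (∀ n, c n = (n ! : ℚ) * PowerSeries.coeff n h) →
      -- the entries of `log(S)⁺`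
      (∀ i j : ℕ, i < j →
        ShadrinZvonkine.stirlingMatrix.log.plus i j = c (j - i + 1) * ((j + 1).choose i : ℚ)) ∧
      -- the numbers defined by `𝐋 = exp 𝐥`: their matrix is `log(S)⁺`, and the conjecture holds
      (∀ α : ℕ → ℕ → ℚ, ShadrinZvonkine.IsShadrinZvonkine α →
        ShadrinZvonkine.strictMatrix α = ShadrinZvonkine.stirlingMatrix.log.plus ∧
        (∀ i j : ℕ, i < j → α i j = c (j - i + 1) * ((j + 1).choose i : ℚ))) ∧
      -- the first terms of the sequence
      (List.ofFn fun i : Fin 13 => c (i + 1)) =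
        [0, 1, -1 / 2, 1 / 2, -2 / 3, 11 / 12, -3 / 4, -11 / 6, 29 / 4, 493 / 12, -2711 / 6,
          -12406 / 15, 2636317 / 60] ∧
      -- the explicit formula
      (∀ n : ℕ, 1 ≤ n → c n = ShadrinZvonkine.chainSum n) := by
  refine ⟨ShadrinZvonkine.existsUnique_isIterativeLog_exp_sub_one, fun h hh c hc => ?_⟩
  have hlog : ∀ i j : ℕ, i < j →
      ShadrinZvonkine.stirlingMatrix.log.plus i j = c (j - i + 1) * ((j + 1).choose i : ℚ) :=
    fun i j hij => ShadrinZvonkine.log_stirlingMatrix_succ_apply hh hc hij.le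
  refine ⟨hlog, fun α hα => ⟨hα.strictMatrix_eq, fun i j hij => ?_⟩,
    ShadrinZvonkine.ofFn_eq_first_terms hh hc, fun n hn => ?_⟩
  · rw [← hlog i j hij, ← hα.strictMatrix_eq, ShadrinZvonkine.strictMatrix_apply, if_pos hij]
  · rw [← ShadrinZvonkine.log_stirlingMatrix_one_apply hh hc hn,
      ShadrinZvonkine.log_stirlingMatrix_one_eq_chainSum]
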